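/- A finite loopless digraph on $v$ vertices is a *directed strongly regular graph* (DSRG) with parameters $(v,k,\lambda,\mu,t)$ if every vertex has out-degree and in-degree $k$; for every vertex $x$ there are exactly $t$ vertices $y$ such that both $(x,y)$ and $(y,x)$ are arcs; and for any two distinct vertices $x,y$ the number of vertices $z$ such that $(x,z)$ and $(z,y)$ are arcs is $\lambda$ if $(x,y)$ is an arc and $\mu$ otherwise. It is *genuine* if $0<t<k$. For a group $G$ and $S\subseteq G$, the Cayley digraph $\mathrm{Cay}(G,S)$ has vertex set $G$ and arcs $(x,xs)$ for $x\in G$, $s\in S$; the set $S$ is called its connection set. **Theorem 4.6.** Let $q=1+3b^2$ be a prime power, where $b$ is an even integer, and suppose that $2$ is a cube in $\mathbb F_q$. Let $\omega$ be a primitive element of $\mathbb F_q$, let $C_0=\langle\omega^6\rangle\le\mathbb F_q^\ast$ and $C_3=\omega^3C_0$. Let $H$ be the additive group of $\mathbb F_q$, let $\rho\in\mathrm{Aut}(H)$ be the automorphism $\rho(x)=\omega^6x$, let $K=\langle\rho\rangle$ (a group of order $(q-1)/6$), and let $G=H\rtimes K$, with multiplication $(h,\phi)(h',\phi')=(h+\phi(h'),\phi\phi')$.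 Put $$W=(-1+C_3,K)=\{(-1+d,\phi) : d\in C_3,\ \phi\in K\}\subseteq G .$$ Then $\mathrm{Cay}(G,W)$ is a genuine DSRG with parameters $$v=\frac{(q-1)q}{6},\quad k=\frac{(q-1)^2}{36},\quad \lambda=\frac{(q-1)^2}{216}-\frac{q-1}{36},\quad \mu=\frac{(q-1)^2}{216},\quad t=\frac{(q-1)^2}{216};$$ in particular, these five numbers are integers. -/

import Mathlib

/-- A finite digraph is a directed strongly regular graph (DSRG) with `v` vertices, valency `k`,
`lam` directed 2-paths along each arc, `mu` directed 2-paths between distinct non-adjacent ordered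
pairs, and `t` undirected edges at each vertex. -/
structure IsDSRG {V : Type*} (Γ : Digraph V) (v k lam mu t : ℕ) : Prop where
  finite : Finite V
  card_eq : Nat.card V = v
  loopless : ∀ x, ¬ Γ.Adj x x
  out_degree : ∀ x, {y | Γ.Adj x y}.ncard = k
  in_degree : ∀ x, {z | Γ.Adj z x}.ncard = k
  undirected : ∀ x, {y | Γ.Adj x y ∧ Γ.Adj y x}.ncard = t
  paths_adj : ∀ x y, x ≠ y → Γ.Adj x y → {z | Γ.Adj x z ∧ Γ.Adj z y}.ncard = lam
  paths_not_adj : ∀ x y, x ≠ y → ¬ Γ.Adj x y → {z | Γ.Adj x z ∧ Γ.Adj z y}.ncard = mu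

/-- The Cayley digraph `Cay(G, S)` with connection set `S`: `(x, y)` is an arc iff `y ∈ x S`. -/
def cayleyDigraph {G : Type*} [Group G] (S : Set G) : Digraph G where
  Adj x y := x⁻¹ * y ∈ S

/-- The cyclotomic coset `C_i = ω ^ i C_0` of order `e`, where `C_0` is the subgroup generated by
`ω ^ e`, as a subset of the field. -/
def cyclotomicCoset {F : Type*} [Field F] (ω : Fˣ) (e i : ℕ) : Set F :=
  {x | ∃ c ∈ Subgroup.zpowers (ω ^ e), x = ((ω ^ i * c : Fˣ) : F)}

/-- The automorphism `ρ : x ↦ ω ^ e * x` of the additive group of `F` (written multiplicatively). -/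
def multiplierAut {F : Type*} [Field F] (ω : Fˣ) (e : ℕ) : MulAut (Multiplicative F) :=
  AddEquiv.toMultiplicative (DistribMulAction.toAddEquiv F (ω ^ e))

/-- The automorphism group `K = ⟨ρ⟩` of the additive group of `F`. -/
def multiplierGroup {F : Type*} [Field F] (ω : Fˣ) (e : ℕ) : Subgroup (MulAut (Multiplicative F)) :=
  Subgroup.zpowers (multiplierAut ω e)

/-- The semidirect product `H ⋊ K` of the additive group `H` of `F` by `K = ⟨ρ⟩`, with
`(h, k) (h', k') = (h + k h', k k')`. -/
abbrev FieldSemidirect {F : Type*} [Field F] (ω : Fˣ) (e : ℕ) : Type _ :=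
  SemidirectProduct (Multiplicative F) (multiplierGroup ω e) (multiplierGroup ω e).subtype

/-- The set `(-1 + D, K) = {(-1 + d, k) : d ∈ D, k ∈ K}` in `H ⋊ K`. -/
def shiftedSet {F : Type*} [Field F] (ω : Fˣ) (e : ℕ) (D : Set F) : Set (FieldSemidirect ω e) :=
  {g | ∃ d ∈ D, g.left = Multiplicative.ofAdd (-1 + d)}

/-!
Put `W = (-1 + C₃, K)`. For `g = (l, ψ)` the number of factorizations
of `g` in `W * W` is the number of pairs `(h, c)` with `h + 1 ∈ C₃`, `c ∈ C₀` and
`c⁻¹ * (l - h) + 1 ∈ C₃`. If for every `y ≠ 0` the condition `c * y + 1 ∈ C₃` has the same number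
`u` of solutions `c ∈ C₀`, this number of pairs is `u * (|C₃| - 1)` for `g ∈ W` and `u * |C₃|`
otherwise, which is strong regularity (`isDSRG_cayleyDigraph_shiftedSet`). So the claim is that the
cyclotomic numbers `(3, i)` of order six are all equal to `u = (q - 1) / 36`.

Let `χ` be a character of order six. By orthogonality the cyclotomic numbers are equal as soon as
`∑ k, (-1) ^ k * J(χ ^ j, χ ^ k) = 0` for `j = 1, …, 5`
(`card_mulChar_eq_and_mulChar_one_sub`). Since `-1` is a sixth power and `2` is a cube, the
reflection `J(α, β) = J(α, (α * β)⁻¹)` and the duplication formula `J(α, α) = J(α, χ ^ 3)` identify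
all nontrivial `J(χ ^ j, χ ^ k)` with `J = J(χ ^ 2, χ ^ 2)` or its conjugate, and all five sums
vanish if `J` has real part `-1` (`sum_neg_one_pow_mul_jacobiSum`).

Write `J = A + B * √-3`. As `2` is a cube, `A` and `B` are integers, and `A ≡ -1` modulo `3`; also
`A ^ 2 + 3 * B ^ 2 = q = 1 + 3 * b ^ 2`. The representation of `q = p ^ n` by this form with
`p ∤ A` is unique up to signs (`sq_eq_one_of_sq_add_three_mul_sq`), so that `A = -1` follows from
`p ∤ A`. If `p` divided `A`, it would divide `B`, and the Jacobi sum of a cubic character with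
values in `F` would vanish; but that sum is `± (2 * f).choose f` with `f = (q - 1) / 3`, which is
prime to `p` by Kummer's theorem when `p ≡ 1` modulo `3` (`cubicCount_not_all_congr`). Primes
`p ≡ 2` modulo `3` do not occur: `q` would be a square, even a fourth power, and
`w ^ 4 = 1 + 3 * b ^ 2` with `b` even has only trivial solutions (`eq_one_of_pow_four_eq`).
-/

/-! ### The equation `p ^ n = 1 + 3 b ^ 2` -/

theorem Int.sq_emod_three_ne_two (s : ℤ) : s ^ 2 % 3 ≠ 2 := by
  have : s % 3 = 0 ∨ s % 3 = 1 ∨ s % 3 = 2 := by omega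
  rcases this with h | h | h <;> simp [pow_two, Int.mul_emod, h]

theorem Int.exists_eq_sq_of_mul_eq_sq {a b c : ℤ} (ha : 0 ≤ a) (hab : IsCoprime a b)
    (h : a * b = c ^ 2) : ∃ r : ℤ, a = r ^ 2 := by
  obtain ⟨r, hr | hr⟩ := Int.sq_of_isCoprime hab h
  · exact ⟨r, hr⟩
  · exact ⟨0, by nlinarith [sq_nonneg r]⟩

/-- Parametrization of the Pythagorean triples with consecutive legs, the smaller one even. -/
theorem exists_param_of_sq_add_succ_sq {k x : ℤ} (hk : Even k) (hk0 : 0 ≤ k)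
    (hx : k ^ 2 + (k + 1) ^ 2 = x ^ 2) :
    ∃ m n : ℤ, k = 2 * m * n ∧ k + 1 = m ^ 2 - n ^ 2 ∧ IsCoprime m n ∧ m % 2 = 1 ∧ n % 2 = 0 ∧
      0 ≤ m := by
  have hT : PythagoreanTriple (k + 1) k |x| := by
    unfold PythagoreanTriple
    rw [abs_mul_abs_self]
    linarith
  obtain ⟨m, n, h1, h2, -, hc, hpar, hm⟩ := hT.coprime_classification'
    (Int.isCoprime_iff_gcd_eq_one.mp ⟨1, -1, by ring⟩) (by have := Int.even_iff.mp hk; omega)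
    (abs_pos.mpr fun h0 ↦ by rw [h0] at hx; nlinarith [sq_nonneg k])
  refine ⟨m, n, h2, h1, Int.isCoprime_iff_gcd_eq_one.mpr hc, ?_⟩
  rcases hpar with ⟨hm2, hn2⟩ | ⟨hm2, hn2⟩
  · -- For odd `n` the identity `(m - n) ^ 2 = 1 + 2 * n ^ 2` fails modulo `4`.
    exfalso
    obtain ⟨i, rfl⟩ := Int.dvd_of_emod_eq_zero hm2
    obtain ⟨j, rfl⟩ : ∃ j, n = 2 * j + 1 := ⟨n / 2, by omega⟩
    ring_nf at h1 h2
    omega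
  · exact ⟨hm2, hn2, hm⟩

/-- In a Pythagorean triple with legs `k`, `k + 1`, where `k` is even and `k + 1` is a square,
`k` vanishes. -/
theorem eq_zero_of_sq_add_succ_sq {k x r : ℤ} (hk : Even k) (hk0 : 0 ≤ k)
    (hx : k ^ 2 + (k + 1) ^ 2 = x ^ 2) (hr : k + 1 = r ^ 2) : k = 0 := by
  obtain ⟨m, n, h2, h1, hc, hm2, hn2, hm⟩ := exists_param_of_sq_add_succ_sq hk hk0 hx
  obtain ⟨j, rfl⟩ := Int.dvd_of_emod_eq_zero hn2
  have hj : 0 ≤ j := by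
    by_contra hj
    rcases hm.lt_or_eq with hm | rfl
    · nlinarith
    · omega
  have hpos : 0 ≤ m - 2 * j := by
    by_contra hlt
    nlinarith
  have hcop : IsCoprime (m - 2 * j) (m + 2 * j) := by
    have h3 : IsCoprime (m - 2 * j) (2 * (2 * j)) := by
      refine IsCoprime.mul_right ⟨1, -(m / 2 - j), by
        have := Int.emod_add_mul_ediv m 2
        linarith⟩ ?_
      simpa [sub_eq_add_neg, add_comm] using hc.add_mul_right_left (-1)
    have := h3.add_mul_left_right 1
    convert! this using 1
    ring
  obtain ⟨f, hf⟩ := Int.exists_eq_sq_of_mul_eq_sq hpos hcop (c := r) (by linarith)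
  -- Now `f ^ 4 = 1 + 8 * j ^ 2`, so `f ^ 2 = 2 * g + 1` and `g * (g + 1) = 2 * j ^ 2`.
  obtain ⟨g, hg⟩ : ∃ g, m = 2 * g + 1 := ⟨m / 2, by omega⟩
  have h4 : (f ^ 2) ^ 2 = 1 + 8 * j ^ 2 := by rw [← hf]; linarith
  have hfo : f % 2 = 1 := by
    rcases Int.emod_two_eq_zero_or_one f with h | h
    · obtain ⟨t, rfl⟩ := Int.dvd_of_emod_eq_zero h
      ring_nf at hf; omega
    · exact h
  obtain ⟨e, rfl⟩ : ∃ e, f = 2 * e + 1 := ⟨f / 2, by omega⟩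
  have he : (e ^ 2 + e) * (2 * (e ^ 2 + e) + 1) = j ^ 2 := by
    linarith
  have he0 : 0 ≤ e ^ 2 + e := by
    rcases le_or_gt 0 e with h | h <;> nlinarith
  obtain ⟨i, hi⟩ := Int.exists_eq_sq_of_mul_eq_sq he0 ⟨-2, 1, by ring⟩ he
  -- `e * (e + 1)` is a square only for `e = 0, -1`.
  have hi0 : (2 * e + 1 - 2 * i) * (2 * e + 1 + 2 * i) = 1 := by linarith
  have : i = 0 := by
    rcases Int.mul_eq_one_iff_eq_one_or_neg_one.mp hi0 with h | h <;> omega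
  have hj0 : j = 0 := by
    rw [hi, this] at he
    simpa using he.symm
  rw [h2, hj0]; ring

/-- The equation `s ^ 2 = 1 + 3 * b ^ 2` with `b` even has no positive solution with
`s ≡ 2` modulo `3`. -/
theorem emod_three_ne_two_of_sq_eq {s b : ℤ} (hs : 0 < s) (hb : Even b)
    (h : s ^ 2 = 1 + 3 * b ^ 2) : s % 3 ≠ 2 := by
  intro h3
  obtain ⟨c, rfl⟩ := hb
  have hodd : s % 2 = 1 := by
    rcases Int.emod_two_eq_zero_or_one s with h2 | h2
    · obtain ⟨t, rfl⟩ := Int.dvd_of_emod_eq_zero h2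
      ring_nf at h; omega
    · exact h2
  obtain ⟨m, rfl⟩ : ∃ m, s = 2 * (3 * m + 2) + 1 := ⟨(s - 5) / 6, by omega⟩
  have hc : (3 * m + 2) * (m + 1) = c ^ 2 := by linarith
  obtain ⟨r, hr⟩ := Int.exists_eq_sq_of_mul_eq_sq (by omega) ⟨-1, 3, by ring⟩ hc
  exact Int.sq_emod_three_ne_two r (by omega)

/-- The equation `w ^ 4 = 1 + 3 * b ^ 2` with `b` even has only the trivial solution. For
`w = 2 * k + 1` the factors of `w ^ 4 - 1` make `k`, `k + 1` the legs of a Pythagorean triple. -/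
theorem eq_one_of_pow_four_eq {w b : ℤ} (hw : 0 < w) (hb : Even b) (h : w ^ 4 = 1 + 3 * b ^ 2) :
    w = 1 := by
  obtain ⟨c, rfl⟩ := hb
  have hodd : w % 2 = 1 := by
    rcases Int.emod_two_eq_zero_or_one w with h2 | h2
    · obtain ⟨t, rfl⟩ := Int.dvd_of_emod_eq_zero h2
      ring_nf at h; omega
    · exact h2
  obtain ⟨k, rfl⟩ : ∃ k, w = 2 * k + 1 := ⟨w / 2, by omega⟩
  have hk0 : 0 ≤ k := by omega
  have hk : 2 * (k ^ 2 + k) * (2 * (k ^ 2 + k) + 1) = 3 * c ^ 2 := by linarith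
  obtain ⟨N, hN⟩ : ∃ N, k ^ 2 + k = 3 * N := by
    have : k % 3 = 0 ∨ k % 3 = 1 ∨ k % 3 = 2 := by omega
    rcases this with h3 | h3 | h3
    · obtain ⟨a, rfl⟩ := Int.dvd_of_emod_eq_zero h3
      exact ⟨3 * a ^ 2 + a, by ring⟩
    · obtain ⟨a, rfl⟩ : ∃ a, k = 3 * a + 1 := ⟨k / 3, by omega⟩
      ring_nf at hk
      omega
    · obtain ⟨a, rfl⟩ : ∃ a, k = 3 * a + 2 := ⟨k / 3, by omega⟩
      exact ⟨3 * a ^ 2 + 5 * a + 2, by ring⟩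
  have hN0 : 0 ≤ N := by nlinarith
  rw [hN] at hk
  have hNc : (2 * N) * (6 * N + 1) = c ^ 2 := by linarith
  obtain ⟨y, hy⟩ := Int.exists_eq_sq_of_mul_eq_sq (by omega) ⟨-3, 1, by ring⟩ hNc
  obtain ⟨x, hx⟩ := Int.exists_eq_sq_of_mul_eq_sq (a := 6 * N + 1) (b := 2 * N) (c := c)
    (by omega) ⟨1, -3, by ring⟩ (by linarith)
  have hpy : k ^ 2 + (k + 1) ^ 2 = x ^ 2 := by linarith
  have hy2 : y % 2 = 0 := by
    rcases Int.emod_two_eq_zero_or_one y with h2 | h2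
    · exact h2
    · obtain ⟨t, rfl⟩ : ∃ t, y = 2 * t + 1 := ⟨y / 2, by omega⟩
      ring_nf at hy; omega
  obtain ⟨z, rfl⟩ := Int.dvd_of_emod_eq_zero hy2
  have hz : k ^ 2 + k = 6 * z ^ 2 := by linarith
  suffices k = 0 by omega
  have h6 : k % 6 = 0 ∨ k % 6 = 1 ∨ k % 6 = 2 ∨ k % 6 = 3 ∨ k % 6 = 4 ∨ k % 6 = 5 := by omega
  rcases h6 with h6 | h6 | h6 | h6 | h6 | h6
  · obtain ⟨a, rfl⟩ := Int.dvd_of_emod_eq_zero h6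
    obtain ⟨r, hr⟩ := Int.exists_eq_sq_of_mul_eq_sq (a := 6 * a + 1) (b := a) (c := z)
      (by omega) ⟨1, -6, by ring⟩ (by linarith)
    exact eq_zero_of_sq_add_succ_sq ⟨3 * a, by ring⟩ hk0 hpy hr
  · obtain ⟨a, rfl⟩ : ∃ a, k = 6 * a + 1 := ⟨k / 6, by omega⟩
    ring_nf at hz; omega
  · -- Here `k = 2 * r ^ 2` and `k + 1 = 3 * s ^ 2 ≡ 3` modulo `4`.
    obtain ⟨a, rfl⟩ : ∃ a, k = 6 * a + 2 := ⟨k / 6, by omega⟩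
    obtain ⟨s, hs⟩ := Int.exists_eq_sq_of_mul_eq_sq (a := 2 * a + 1) (b := 3 * a + 1) (c := z)
      (by omega) ⟨3, -2, by ring⟩ (by linarith)
    obtain ⟨m, n, -, h1, -, hm2, hn2, -⟩ :=
      exists_param_of_sq_add_succ_sq ⟨3 * a + 1, by ring⟩ hk0 hpy
    obtain ⟨i, rfl⟩ : ∃ i, m = 2 * i + 1 := ⟨m / 2, by omega⟩
    obtain ⟨j, rfl⟩ := Int.dvd_of_emod_eq_zero hn2
    rcases Int.emod_two_eq_zero_or_one s with h2 | h2
    · obtain ⟨t, rfl⟩ := Int.dvd_of_emod_eq_zero h2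
      ring_nf at hs; omega
    · obtain ⟨t, rfl⟩ : ∃ t, s = 2 * t + 1 := ⟨s / 2, by omega⟩
      ring_nf at hs h1; omega
  · obtain ⟨a, rfl⟩ : ∃ a, k = 6 * a + 3 := ⟨k / 6, by omega⟩
    obtain ⟨r, hr⟩ := Int.exists_eq_sq_of_mul_eq_sq (a := 3 * a + 2) (b := 2 * a + 1) (c := z)
      (by omega) ⟨2, -3, by ring⟩ (by linarith)
    exact (Int.sq_emod_three_ne_two r (by omega)).elim
  · obtain ⟨a, rfl⟩ : ∃ a, k = 6 * a + 4 := ⟨k / 6, by omega⟩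
    ring_nf at hz; omega
  · obtain ⟨a, rfl⟩ : ∃ a, k = 6 * a + 5 := ⟨k / 6, by omega⟩
    obtain ⟨r, hr⟩ := Int.exists_eq_sq_of_mul_eq_sq (a := 6 * a + 5) (b := a + 1) (c := z)
      (by omega) ⟨-1, 6, by ring⟩ (by linarith)
    exact (Int.sq_emod_three_ne_two r (by omega)).elim

/-- A nontrivial prime power of the form `1 + 3 * b ^ 2` with `b` even is a power of a prime
`p ≡ 1` modulo `3`. -/
theorem prime_mod_three_eq_one_of_pow_eq {p n : ℕ} (hp : p.Prime) (hn : n ≠ 0) {b : ℤ}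
    (hb : Even b) (h : (p : ℤ) ^ n = 1 + 3 * b ^ 2) : p % 3 = 1 := by
  have h3 : p % 3 = 0 ∨ p % 3 = 1 ∨ p % 3 = 2 := by omega
  have hpos : ∀ k, 0 < (p : ℤ) ^ k := fun k ↦ pow_pos (mod_cast hp.pos) k
  have hmod : ∀ k, p % 3 = 2 → ((p : ℤ) ^ k) % 3 = if Even k then 1 else 2 := by
    intro k h3
    have : (p : ℤ) ≡ -1 [ZMOD 3] := by
      unfold Int.ModEq
      omega
    have h4 := this.pow k
    unfold Int.ModEq at h4
    split_ifs with hk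
    · rw [h4, hk.neg_one_pow]; rfl
    · rw [h4, (Nat.not_even_iff_odd.mp hk).neg_one_pow]; rfl
  rcases h3 with h3 | h3 | h3
  · obtain ⟨t, ht⟩ : (3 : ℤ) ∣ (p : ℤ) ^ n := dvd_pow (by omega) hn
    omega
  · exact h3
  · exfalso
    have hev : Even n := by
      by_contra hne
      have := hmod n h3
      rw [if_neg hne] at this
      omega
    obtain ⟨r, rfl⟩ := hev
    have h' : ((p : ℤ) ^ r) ^ 2 = 1 + 3 * b ^ 2 := by rw [← h]; ring
    have hr : Even r := by
      by_contra hne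
      exact emod_three_ne_two_of_sq_eq (hpos r) hb h' ((hmod r h3).trans (if_neg hne))
    obtain ⟨m, rfl⟩ := hr
    have h1 := eq_one_of_pow_four_eq (hpos m) hb (by rw [← h]; ring)
    have : (1 : ℤ) < (p : ℤ) ^ m := one_lt_pow₀ (mod_cast hp.one_lt) (by omega)
    omega

/-- If `p ^ n = 1 + 3 * b ^ 2 = A ^ 2 + 3 * B ^ 2` with `p` not dividing `A`, then `A = 1` or
`A = -1`. -/
theorem sq_eq_one_of_sq_add_three_mul_sq {p n : ℕ} (hp : p.Prime) (hp2 : p ≠ 2) (hn : n ≠ 0)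
    {A B b : ℤ} (hA : ¬ (p : ℤ) ∣ A) (h1 : (p : ℤ) ^ n = 1 + 3 * b ^ 2)
    (h2 : A ^ 2 + 3 * B ^ 2 = (p : ℤ) ^ n) : A ^ 2 = 1 := by
  have hpp : Prime (p : ℤ) := Nat.prime_iff_prime_int.mp hp
  have hpos : 0 < (p : ℤ) ^ n := pow_pos (mod_cast hp.pos) n
  -- Multiplying the two representations gives `X ^ 2 + 3 * Y ^ 2 = q ^ 2` with `q ∣ Y`,
  -- hence `Y = 0`.
  have key : ∀ C : ℤ, (p : ℤ) ^ n ∣ b * A - C → A ^ 2 + 3 * C ^ 2 = (p : ℤ) ^ n → A ^ 2 = 1 := by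
    intro C hd hC
    have hid : (A + 3 * b * C) ^ 2 + 3 * (b * A - C) ^ 2 = ((p : ℤ) ^ n) ^ 2 := by
      linear_combination (1 + 3 * b ^ 2) * hC - (p : ℤ) ^ n * h1
    have h0 : b * A - C = 0 := by
      obtain ⟨t, ht⟩ := hd
      by_contra hne
      have ht0 : t ≠ 0 := by rintro rfl; simp at ht; exact hne ht
      have ht1 : 1 ≤ t ^ 2 := by have := sq_pos_of_ne_zero ht0; omega
      rw [ht] at hid
      nlinarith [sq_nonneg (A + 3 * b * C), mul_pos hpos hpos]
    have hC' : C = b * A := by linarith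
    rw [hC'] at hC
    have : (p : ℤ) ^ n * A ^ 2 = (p : ℤ) ^ n * 1 := by
      linear_combination A ^ 2 * h1 + hC
    exact mul_left_cancel₀ hpos.ne' this
  have hprod : (p : ℤ) ^ n ∣ (b * A - B) * (b * A + B) :=
    ⟨b ^ 2 - B ^ 2, by linear_combination b ^ 2 * h2 + B ^ 2 * h1⟩
  by_cases hd : (p : ℤ) ∣ b * A - B
  · have hnd : ¬ (p : ℤ) ∣ b * A + B := by
      intro hd'
      have h3 : (p : ℤ) ∣ 2 * (b * A) := by
        have := dvd_add hd hd'
        convert! this using 1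
        ring
      rcases hpp.dvd_or_dvd h3 with h3 | h3
      · have := Int.le_of_dvd (by norm_num) h3
        have := hp.two_le
        omega
      rcases hpp.dvd_or_dvd h3 with h3 | h3
      · have h4 : (p : ℤ) ∣ 1 := by
          have : (p : ℤ) ∣ (p : ℤ) ^ n - 3 * b * b :=
            dvd_sub (dvd_pow_self _ hn) (Dvd.dvd.mul_left h3 _)
          rw [h1] at this
          convert! this using 1
          ring
        exact hpp.not_isUnit (isUnit_of_dvd_one h4)
      · exact hA h3
    exact key B (IsCoprime.dvd_of_dvd_mul_right
      (((hpp.coprime_iff_not_dvd).mpr hnd).pow_left) hprod) h2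
  · have h5 : (p : ℤ) ^ n ∣ b * A + B := IsCoprime.dvd_of_dvd_mul_left
      (((hpp.coprime_iff_not_dvd).mpr hd).pow_left) hprod
    exact key (-B) (by simpa using h5) (by simpa using h2)

/-! ### A binomial coefficient as a Jacobi sum in characteristic `p` -/

open Finset in
/-- For `q = p ^ n = 3 * f + 1` with `p ≡ 1` modulo `3` all base-`p` digits of `f` are
`(p - 1) / 3`, so that adding `f` to itself produces no carry. -/
theorem not_dvd_choose_two_mul {p n f : ℕ} (hp : p.Prime) (hp3 : p % 3 = 1)
    (hf : p ^ n = 3 * f + 1) : ¬ p ∣ (2 * f).choose f := by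
  have hk := hp.emultiplicity_choose (n := 2 * f) (k := f) (by omega) (Nat.lt_succ_self _)
  rw [← emultiplicity_eq_zero, hk, Nat.cast_eq_zero, card_eq_zero, filter_eq_empty_iff]
  intro i hi
  rw [two_mul, Nat.add_sub_cancel, not_le]
  have hmod : ∀ j, p ^ j % 3 = 1 := fun j ↦ by simp [Nat.pow_mod, hp3]
  have hlt : f % p ^ i < p ^ i := Nat.mod_lt _ (pow_pos hp.pos i)
  rcases le_or_gt n i with hin | hin
  · have h1 : p ^ n ≤ p ^ i := Nat.pow_le_pow_right hp.pos hin
    rw [Nat.mod_eq_of_lt (by omega)]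
    omega
  · have h1 : p ^ n = p ^ i * p ^ (n - i) := by rw [← pow_add]; congr 1; omega
    have hi3 := hmod i
    have hni3 := hmod (n - i)
    obtain ⟨d, hd⟩ : ∃ d, p ^ i = 3 * d + 1 := ⟨p ^ i / 3, by omega⟩
    obtain ⟨g, hg⟩ : ∃ g, p ^ (n - i) = 3 * g + 1 := ⟨p ^ (n - i) / 3, by omega⟩
    have hfd : f = d + p ^ i * g := by
      rw [hf, hg, hd] at h1
      rw [hd]
      linarith
    have : f % p ^ i = d := by
      rw [hfd, Nat.add_mul_mod_self_left, Nat.mod_eq_of_lt (by omega)]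
    omega

open Finset in
/-- The Jacobi sum of `x ↦ x ^ (2 * (q - 1) / 3)`, a multiplicative character with values in the
finite field itself, is a binomial coefficient up to sign. -/
theorem sum_pow_mul_one_sub_pow {F : Type*} [Field F] [Fintype F] {f : ℕ} (hf0 : f ≠ 0)
    (hf : Fintype.card F = 3 * f + 1) :
    ∑ x : F, x ^ (2 * f) * (1 - x) ^ (2 * f) = -((-1) ^ f * ((2 * f).choose f : F)) := by
  classical
  have hpow : ∀ k ∈ range (2 * f + 1), ∑ x : F, x ^ (2 * f + k) = if k = f then -1 else 0 := by
    intro k hk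
    rw [mem_range] at hk
    rcases lt_trichotomy k f with h | rfl | h
    · rw [if_neg h.ne]
      exact FiniteField.sum_pow_lt_card_sub_one F _ (by omega)
    · have hx : ∀ x : F, x ^ (2 * k + k) = 1 - if x = 0 then 1 else 0 := by
        intro x
        split_ifs with h
        · simp [h, hf0]
        · rw [show 2 * k + k = Fintype.card F - 1 by omega, FiniteField.pow_card_sub_one_eq_one x h,
            sub_zero]
      simp [hx]
    · have hx : ∀ x : F, x ^ (2 * f + k) = x ^ (k - f) := by
        intro x
        rw [show 2 * f + k = Fintype.card F + (k - f - 1) by omega, pow_add, FiniteField.pow_card,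
          ← pow_succ']
        congr 1; omega
      simp_rw [hx]
      rw [if_neg h.ne']
      exact FiniteField.sum_pow_lt_card_sub_one F _ (by omega)
  have hexp : ∀ x : F, x ^ (2 * f) * (1 - x) ^ (2 * f) =
      ∑ k ∈ range (2 * f + 1), (-1) ^ k * ((2 * f).choose k : F) * x ^ (2 * f + k) := by
    intro x
    rw [sub_eq_neg_add, add_pow, mul_sum]
    refine sum_congr rfl fun k _ ↦ ?_
    rw [neg_pow, pow_add]
    ring
  simp_rw [hexp]
  rw [sum_comm]
  simp_rw [← mul_sum]
  rw [sum_congr rfl fun k hk ↦ by rw [hpow k hk]]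
  simp [show f < 2 * f + 1 by omega]

/-! ### Jacobi sums of cubic characters -/

section JacobiSums

open Finset

/-- The substitution `x ↦ x / (x - 1)` in a Jacobi sum. -/
theorem jacobiSum_eq_jacobiSum_mul_inv {F R : Type*} [Field F] [Fintype F] [Field R]
    {α : MulChar F R} (hα : α (-1) = 1) (β : MulChar F R) :
    jacobiSum α β = jacobiSum α (α * β)⁻¹ := by
  classical
  have hne : ∀ x : F, x ≠ 1 → x - 1 ≠ 0 := fun x hx ↦ sub_ne_zero.mpr hx
  rw [jacobiSum, jacobiSum, ← sum_erase (a := 1) univ (by simp [MulChar.map_zero]),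
    ← sum_erase (a := 1) univ (by simp [MulChar.map_zero])]
  refine sum_nbij' (fun x ↦ x / (x - 1)) (fun x ↦ x / (x - 1)) ?_ ?_ ?_ ?_ ?_
  · intro x hx
    have := hne x (by simpa using hx)
    simp [div_eq_iff this, eq_sub_iff_add_eq]
  · intro x hx
    have := hne x (by simpa using hx)
    simp [div_eq_iff this, eq_sub_iff_add_eq]
  · intro x hx
    have := hne x (by simpa using hx)
    field_simp
    simp
  · intro x hx
    have := hne x (by simpa using hx)
    field_simp
    simp
  · intro x hx
    have h1 := hne x (by simpa using hx)
    have h2 : 1 - x ≠ 0 := by rw [← neg_sub]; exact neg_ne_zero.mpr h1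
    have h3 : 1 - x / (x - 1) = (1 - x)⁻¹ := by field_simp; ring
    have h4 : α (x / (x - 1)) = α x * (α (1 - x))⁻¹ := by
      have : x / (x - 1) = -1 * x * (1 - x)⁻¹ := by field_simp; ring
      rw [this, map_mul, map_mul, hα, one_mul, ← MulChar.inv_apply', MulChar.inv_apply_eq_inv']
    have h5 : α (1 - x) ≠ 0 :=
      (IsUnit.map α (isUnit_iff_ne_zero.mpr h2)).ne_zero
    rw [h3, h4, MulChar.inv_apply', inv_inv, MulChar.mul_apply]
    field_simp

/-- Duplication: `4 * x * (1 - x) = 1 - (1 - 2 * x) ^ 2`, and `z` has `1 + φ z` square roots, where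
`φ` is the quadratic character. -/
theorem jacobiSum_self_mul_apply_four {F R : Type*} [Field F] [Fintype F] [DecidableEq F]
    [Field R] (h2 : (2 : F) ≠ 0) {α φ : MulChar F R} (hα : α ≠ 1)
    (hφ : ∀ x : F, φ x = quadraticChar F x) :
    jacobiSum α α * α 4 = jacobiSum α φ := by
  have hchar : ringChar F ≠ 2 := by
    intro h
    have := ringChar.Nat.cast_ringChar (R := F)
    rw [h] at this
    exact h2 (by exact_mod_cast this)
  have hbij : Function.Bijective fun x : F ↦ 1 - 2 * x := by
    refine Finite.injective_iff_bijective.mp fun x y h ↦ ?_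
    exact mul_left_cancel₀ h2 (sub_right_injective h)
  calc jacobiSum α α * α 4 = ∑ x : F, α (1 - (1 - 2 * x) ^ 2) := by
        rw [jacobiSum, sum_mul]
        refine sum_congr rfl fun x _ ↦ ?_
        rw [← map_mul, ← map_mul]
        congr 1; ring
    _ = ∑ y : F, α (1 - y ^ 2) := hbij.sum_comp fun y ↦ α (1 - y ^ 2)
    _ = ∑ z : F, ∑ y : F with y ^ 2 = z, α (1 - y ^ 2) := (sum_fiberwise _ _ _).symm
    _ = ∑ z : F, (1 + φ z) * α (1 - z) := by
        refine sum_congr rfl fun z _ ↦ ?_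
        rw [sum_congr rfl (g := fun _ ↦ α (1 - z))
          (fun y hy ↦ by rw [(mem_filter.mp hy).2]), sum_const, nsmul_eq_mul]
        congr 1
        have := quadraticChar_card_sqrts hchar z
        rw [Set.toFinset_ofPred] at this
        rw [hφ, add_comm, ← Int.cast_natCast, this]
        push_cast; rfl
    _ = jacobiSum α φ := by
        simp_rw [add_mul, one_mul]
        rw [sum_add_distrib, jacobiSum_comm, jacobiSum, add_eq_right]
        refine ((Equiv.subLeft (1 : F)).sum_comp α).trans ?_
        exact MulChar.sum_eq_zero_of_ne_one hα

/-- The number of `x` for which `x * (1 - x)` lies in the class of cubic residuosity cut out by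
`y ^ f = θ ^ i`, where `q = 3 * f + 1` and `θ` is a primitive cube root of unity. -/
noncomputable def cubicCount {F : Type*} [Field F] [Fintype F] (f : ℕ) (θ : F) (i : ℕ) : ℕ :=
  Nat.card {x : F // (x * (1 - x)) ^ f = θ ^ i}

/-- The class counts compute the Jacobi sum of any cubic character, whatever ring it takes its
values in. -/
theorem jacobiSum_self_eq_cubicCount {F R : Type*} [Field F] [Fintype F] [CommRing R] {f : ℕ}
    (hf : f ≠ 0) {θ : F} (hθ : IsPrimitiveRoot θ 3) {ψ : MulChar F R} {ζ : R}
    (hψ : ∀ y : F, y ≠ 0 → ∃ r < 3, y ^ f = θ ^ r ∧ ψ y = ζ ^ r) :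
    jacobiSum ψ ψ = cubicCount f θ 0 + cubicCount f θ 1 * ζ + cubicCount f θ 2 * ζ ^ 2 := by
  classical
  have hθ0 : θ ≠ 0 := hθ.ne_zero (by norm_num)
  have hpt : ∀ y : F, ψ y = (if y ^ f = θ ^ 0 then 1 else 0) + (if y ^ f = θ ^ 1 then 1 else 0) * ζ
      + (if y ^ f = θ ^ 2 then 1 else 0) * ζ ^ 2 := by
    intro y
    by_cases hy : y = 0
    · subst hy
      simp [hf, MulChar.map_zero, hθ0.symm, (pow_ne_zero 2 hθ0).symm]
    · obtain ⟨r, hr, h1, h2⟩ := hψ y hy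
      have hinj : ∀ j < 3, y ^ f = θ ^ j ↔ r = j := fun j hj ↦
        h1 ▸ ⟨fun h ↦ hθ.pow_inj hr hj h, fun h ↦ by rw [h]⟩
      rw [h2, if_congr (hinj 0 (by norm_num)) rfl rfl, if_congr (hinj 1 (by norm_num)) rfl rfl,
        if_congr (hinj 2 (by norm_num)) rfl rfl]
      interval_cases r <;> simp
  simp_rw [jacobiSum, ← map_mul, hpt]
  simp only [sum_add_distrib, ← sum_mul, sum_boole, cubicCount, Nat.card_eq_fintype_card,
    Fintype.card_subtype]

/-- The involution `x ↦ 1 - x` has the fixed point `1 / 2` only, and `x * (1 - x) = 1 / 4` lies in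
the class of `1` there, since `2` does. -/
theorem even_cubicCount {F : Type*} [Field F] [Fintype F] {f : ℕ}
    (h2f : (2 : F) ^ f = 1) {θ : F} {i : ℕ} (hi : θ ^ i ≠ 1) : Even (cubicCount f θ i) := by
  classical
  rw [cubicCount, Nat.card_eq_fintype_card, Fintype.card_subtype, ← ZMod.natCast_eq_zero_iff_even,
    cast_card]
  refine sum_involution (fun x _ ↦ 1 - x) (fun _ _ ↦ by decide) ?_ ?_ (fun _ _ ↦ by ring)
  · intro x hx _ hfix
    have hx2 : 2 * x = 1 := by linear_combination -hfix
    have h4 : (2 : F) ^ 2 * (x * (1 - x)) = 1 := by linear_combination (1 - 2 * x) * hx2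
    apply hi
    have h5 := congrArg (· ^ f) h4
    simp only [mul_pow, one_pow] at h5
    rw [← pow_mul, mul_comm 2 f, pow_mul, h2f, one_pow, one_mul, ← mul_pow,
      (mem_filter.mp hx).2] at h5
    exact h5
  · intro x hx
    simpa [mul_comm] using hx

/-- A cubic character sends `y` to the root of unity matching `y ^ f`. -/
theorem exists_pow_eq_and_mulChar_eq {F R : Type*} [Field F] [Fintype F] [CommRing R] {f : ℕ}
    (hf : Fintype.card F = 3 * f + 1) {ω : Fˣ} (hω : ∀ x : Fˣ, x ∈ Subgroup.zpowers ω)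
    {ψ : MulChar F R} {ζ : R} (hζ : ζ ^ 3 = 1) (hψ : ψ ω = ζ) {y : F} (hy : y ≠ 0) :
    ∃ r < 3, y ^ f = ((ω : F) ^ f) ^ r ∧ ψ y = ζ ^ r := by
  obtain ⟨n, hn⟩ := mem_powers_iff_mem_zpowers.mpr (hω (Units.mk0 y hy))
  have hn' : (ω : F) ^ n = y := by simpa using congrArg Units.val hn
  have hθ : ((ω : F) ^ f) ^ 3 = 1 := by
    rw [← pow_mul, mul_comm, show 3 * f = Fintype.card F - 1 by omega]
    exact FiniteField.pow_card_sub_one_eq_one _ ω.ne_zero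
  refine ⟨n % 3, Nat.mod_lt _ (by norm_num), ?_, ?_⟩
  · rw [← pow_eq_pow_mod n hθ, ← hn', ← pow_mul, ← pow_mul, mul_comm]
  · rw [← pow_eq_pow_mod n hζ, ← hn', map_pow, hψ]

theorem isPrimitiveRoot_generator_pow {F : Type*} [Field F] [Fintype F] {d f : ℕ}
    (hf0 : f ≠ 0) (hf : Fintype.card F = d * f + 1) {ω : Fˣ}
    (hω : ∀ x : Fˣ, x ∈ Subgroup.zpowers ω) : IsPrimitiveRoot ((ω : F) ^ f) d := by
  classical
  have ho : orderOf (ω : F) = f * d := by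
    rw [orderOf_units, orderOf_eq_card_of_forall_mem_zpowers hω, Nat.card_eq_fintype_card,
      Fintype.card_units, hf, mul_comm]; rfl
  have := IsPrimitiveRoot.orderOf (ω : F)
  rw [ho] at this
  exact this.pow (Nat.pos_of_ne_zero fun h0 ↦ by
    rcases Nat.mul_eq_zero.mp h0 with h | h
    · exact hf0 h
    · have := Fintype.one_lt_card (α := F)
      simp [hf, h] at this) rfl

theorem cubicCount_sum {F : Type*} [Field F] [Fintype F] {f : ℕ} (hf0 : f ≠ 0)
    (hf : Fintype.card F = 3 * f + 1) {ω : Fˣ} (hω : ∀ x : Fˣ, x ∈ Subgroup.zpowers ω) :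
    (cubicCount f ((ω : F) ^ f) 0 + cubicCount f ((ω : F) ^ f) 1 + cubicCount f ((ω : F) ^ f) 2 : ℤ)
      = Fintype.card F - 2 := by
  rw [← jacobiSum_one_one (F := F) (R := ℤ),
    jacobiSum_self_eq_cubicCount (f := f) (ζ := 1) hf0 (isPrimitiveRoot_generator_pow hf0 hf hω)]
  · simp
  · intro y hy
    exact exists_pow_eq_and_mulChar_eq hf hω (by simp) (MulChar.one_apply_coe ω) hy

/-- The class counts are not all congruent modulo `p ≡ 1`: otherwise the Jacobi sum of the cubic
character `y ↦ y ^ (2 * f)` with values in `F` would vanish. -/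
theorem cubicCount_not_all_congr {F : Type*} [Field F] [Fintype F] {p n f : ℕ} (hp : p.Prime)
    [CharP F p] (hp3 : p % 3 = 1) (hf0 : f ≠ 0) (hpn : Fintype.card F = p ^ n)
    (hf : Fintype.card F = 3 * f + 1) {ω : Fˣ} (hω : ∀ x : Fˣ, x ∈ Subgroup.zpowers ω)
    (h1 : (cubicCount f ((ω : F) ^ f) 1 : F) = cubicCount f ((ω : F) ^ f) 0)
    (h2 : (cubicCount f ((ω : F) ^ f) 2 : F) = cubicCount f ((ω : F) ^ f) 0) : False := by
  have hθ := isPrimitiveRoot_generator_pow hf0 hf hω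
  let ψ : MulChar F F :=
    { toFun := fun y ↦ y ^ (2 * f)
      map_one' := by simp
      map_mul' := fun x y ↦ by simp [mul_pow]
      map_nonunit' := fun y hy ↦ by
        rw [isUnit_iff_ne_zero, not_not] at hy
        simp [hy, hf0] }
  have hψ : ∀ y, ψ y = y ^ (2 * f) := fun _ ↦ rfl
  have hJ := jacobiSum_self_eq_cubicCount (f := f) (ψ := ψ) (ζ := ((ω : F) ^ f) ^ 2) hf0 hθ
    fun y hy ↦ exists_pow_eq_and_mulChar_eq hf hω
      (by rw [← pow_mul, mul_comm, pow_mul, hθ.pow_eq_one, one_pow])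
      (by rw [hψ, ← pow_mul, mul_comm]) hy
  have hsum := sum_pow_mul_one_sub_pow hf0 hf
  rw [jacobiSum] at hJ
  simp_rw [hψ] at hJ
  rw [hsum, h1, h2] at hJ
  have hgeom : 1 + (ω : F) ^ f + ((ω : F) ^ f) ^ 2 = 0 := by
    have := hθ.geom_sum_eq_zero (by norm_num)
    simpa [sum_range_succ] using this
  have h0 : (cubicCount f ((ω : F) ^ f) 0 : F) + cubicCount f ((ω : F) ^ f) 0 * ((ω : F) ^ f) ^ 2
      + cubicCount f ((ω : F) ^ f) 0 * (((ω : F) ^ f) ^ 2) ^ 2 = 0 := by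
    linear_combination cubicCount f ((ω : F) ^ f) 0 * hgeom +
      cubicCount f ((ω : F) ^ f) 0 * (ω : F) ^ f * hθ.pow_eq_one
  rw [h0, neg_eq_zero, mul_eq_zero, CharP.cast_eq_zero_iff F p] at hJ
  rcases hJ with hJ | hJ
  · exact pow_ne_zero f (by simp) hJ
  · exact not_dvd_choose_two_mul hp hp3 (hpn.symm.trans hf) hJ

/-- If `q = 1 + 3 * b ^ 2` with `b` even and `2` is a cube, the Jacobi sum `J(ψ, ψ)` of a cubic
character has real part `-1`. -/
theorem jacobiSum_self_add_jacobiSum_inv {F : Type*} [Field F] [Fintype F] {b : ℤ} (hb : Even b)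
    (hq : (Fintype.card F : ℤ) = 1 + 3 * b ^ 2) (h2 : ∃ c : F, c ^ 3 = 2) {ω : Fˣ}
    (hω : ∀ x : Fˣ, x ∈ Subgroup.zpowers ω) {ψ : MulChar F ℂ} {w : ℂ} (hw : IsPrimitiveRoot w 3)
    (hψ : ψ ω = w) : jacobiSum ψ ψ + jacobiSum ψ⁻¹ ψ⁻¹ = -2 := by
  obtain ⟨p, hchar⟩ := CharP.exists F
  obtain ⟨⟨n, hn⟩, hp, hpn⟩ := FiniteField.card F p
  have hn0 : n ≠ 0 := hn.ne'
  simp only [PNat.mk_coe] at hpn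
  have hpn' : (p : ℤ) ^ n = 1 + 3 * b ^ 2 := by rw [← hq, hpn]; push_cast; rfl
  have hp3 := prime_mod_three_eq_one_of_pow_eq hp hn0 hb hpn'
  have hp2 : p ≠ 2 := by rintro rfl; omega
  have h20 : (2 : F) ≠ 0 := by
    intro h
    have := (CharP.cast_eq_zero_iff F p 2).mp (by exact_mod_cast h)
    exact hp2 ((Nat.prime_dvd_prime_iff_eq hp Nat.prime_two).mp this)
  have h1q := Fintype.one_lt_card (α := F)
  obtain ⟨f, hf⟩ : ∃ f, Fintype.card F = 3 * f + 1 := ⟨(b ^ 2).toNat, by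
    have := sq_nonneg b
    omega⟩
  have hf0 : f ≠ 0 := by omega
  have hθ := isPrimitiveRoot_generator_pow hf0 hf hω
  have h2f : (2 : F) ^ f = 1 := by
    obtain ⟨c, hc⟩ := h2
    have hc0 : c ≠ 0 := by rintro rfl; exact h20 (by rw [← hc]; norm_num)
    rw [← hc, ← pow_mul, show 3 * f = Fintype.card F - 1 by omega]
    exact FiniteField.pow_card_sub_one_eq_one c hc0
  have hJ := jacobiSum_self_eq_cubicCount (f := f) (ψ := ψ) hf0 hθ
    fun y hy ↦ exists_pow_eq_and_mulChar_eq hf hω hw.pow_eq_one hψ hy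
  have hw0 : w ≠ 0 := hw.ne_zero (by norm_num)
  have hJ' := jacobiSum_self_eq_cubicCount (f := f) (ψ := ψ⁻¹) hf0 hθ
    fun y hy ↦ exists_pow_eq_and_mulChar_eq hf hω (ζ := w ^ 2)
      (by rw [← pow_mul, mul_comm, pow_mul, hw.pow_eq_one, one_pow])
      (by rw [MulChar.inv_apply_eq_inv', hψ, inv_eq_of_mul_eq_one_right]
          rw [← pow_succ', hw.pow_eq_one]) hy
  obtain ⟨s, hs⟩ := even_cubicCount (i := 1) h2f (by rw [pow_one]; exact hθ.ne_one (by norm_num))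
  obtain ⟨t, ht⟩ := even_cubicCount (i := 2) h2f (hθ.pow_ne_one_of_pos_of_lt
    (by norm_num) (by norm_num))
  have htot := cubicCount_sum hf0 hf hω
  have hcong := cubicCount_not_all_congr hp hp3 hf0 hpn hf hω
  generalize cubicCount f ((ω : F) ^ f) 0 = n₀ at *
  rw [hs, ht] at hcong hJ hJ' htot
  have hgeom : 1 + w + w ^ 2 = 0 := by
    have := hw.geom_sum_eq_zero (by norm_num)
    simpa [sum_range_succ] using this
  have hw3 := hw.pow_eq_one
  have hψ1 : ψ ≠ 1 := by
    rintro rfl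
    rw [MulChar.one_apply_coe] at hψ
    exact hw.ne_one (by norm_num) hψ.symm
  have hψ2 : ψ * ψ ≠ 1 := by
    intro h
    have := congrArg (fun χ : MulChar F ℂ ↦ χ ω) h
    rw [MulChar.one_apply_coe, MulChar.mul_apply, hψ, ← pow_two] at this
    exact hw.pow_ne_one_of_pos_of_lt (by norm_num) (by norm_num) this
  have hnorm : jacobiSum ψ ψ * jacobiSum ψ⁻¹ ψ⁻¹ = Fintype.card F :=
    jacobiSum_mul_jacobiSum_inv (by
      rw [ringChar.eq_zero, ringChar.eq F p]
      exact hp.ne_zero.symm) hψ1 hψ1 hψ2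
  -- `J(ψ, ψ) = A + B * (w - w ^ 2)` with rational integers `A` and `B`.
  obtain ⟨A, hA⟩ : ∃ A : ℤ, A = n₀ - s - t := ⟨_, rfl⟩
  obtain ⟨B, hB⟩ : ∃ B : ℤ, B = s - t := ⟨_, rfl⟩
  have hJA : jacobiSum ψ ψ = A + B * (w - w ^ 2) := by
    rw [hJ, hA, hB]; push_cast; linear_combination (s + t : ℂ) * hgeom
  have hJA' : jacobiSum ψ⁻¹ ψ⁻¹ = A - B * (w - w ^ 2) := by
    rw [hJ', hA, hB]; push_cast
    linear_combination (s + t : ℂ) * hgeom + 2 * (t : ℂ) * w * hw3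
  have hAB : A ^ 2 + 3 * B ^ 2 = (p : ℤ) ^ n := by
    rw [hJA, hJA', hpn] at hnorm
    have h3 : (w - w ^ 2) ^ 2 = -3 := by
      linear_combination (w ^ 2 - 3 * w + 3) * hgeom
    have : ((A ^ 2 + 3 * B ^ 2 : ℤ) : ℂ) = ((p : ℤ) ^ n : ℤ) := by
      push_cast at hnorm ⊢
      linear_combination hnorm + (B : ℂ) ^ 2 * h3
    exact_mod_cast this
  have hpp : Prime (p : ℤ) := Nat.prime_iff_prime_int.mp hp
  have hpA : ¬ (p : ℤ) ∣ A := by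
    intro hdA
    have hdB : (p : ℤ) ∣ B := by
      have h3 : (p : ℤ) ∣ 3 * B ^ 2 := by
        have : (p : ℤ) ∣ (p : ℤ) ^ n - A ^ 2 :=
          dvd_sub (dvd_pow_self _ hn0) (dvd_pow hdA (by norm_num))
        convert! this using 1
        linarith
      rcases hpp.dvd_or_dvd h3 with h3 | h3
      · have h4 : p ∣ 3 := by exact_mod_cast h3
        have := (Nat.prime_dvd_prime_iff_eq hp Nat.prime_three).mp h4
        omega
      · exact hpp.dvd_of_dvd_pow h3
    have hAF : (A : F) = 0 := (CharP.intCast_eq_zero_iff F p A).mpr hdA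
    have hBF : (B : F) = 0 := (CharP.intCast_eq_zero_iff F p B).mpr hdB
    rw [hA] at hAF
    rw [hB] at hBF
    push_cast at hAF hBF hcong
    exact hcong (by linear_combination hBF - hAF) (by linear_combination -hBF - hAF)
  have hA1 := sq_eq_one_of_sq_add_three_mul_sq hp hp2 hn0 hpA hpn' hAB
  have hA2 : A = -1 := by
    rcases eq_or_eq_neg_of_sq_eq_sq A 1 (by rw [hA1, one_pow]) with h | h
    · push_cast at htot
      omega
    · exact h
  rw [hJA, hJA', hA2]
  push_cast; ring

/-! ### Jacobi sums of sextic characters and cyclotomic numbers -/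

/-- For a sextic character `χ` the Jacobi sums `J(χ ^ j, χ ^ k)` cancel in the alternating sum over
`k` for each `j ≠ 0`. By reflection and duplication, each of them in which none of `χ ^ j`, `χ ^ k`,
`χ ^ (j + k)` is trivial equals `J(χ ^ 2, χ ^ 2)` or its conjugate `J(χ ^ 4, χ ^ 4)`. -/
theorem sum_neg_one_pow_mul_jacobiSum {F : Type*} [Field F] [Fintype F] [DecidableEq F]
    {χ : MulChar F ℂ} (h20 : (2 : F) ≠ 0) (hχ : orderOf χ = 6) (hχ1 : χ (-1) = 1) (hχ4 : χ 4 = 1)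
    (hφ : ∀ x : F, (χ ^ 3) x = quadraticChar F x)
    (hJ : jacobiSum (χ ^ 2) (χ ^ 2) + jacobiSum (χ ^ 4) (χ ^ 4) = -2) {j : ℕ} (hj : j < 6) :
    ∑ k ∈ range 6, (-1) ^ k * jacobiSum (χ ^ j) (χ ^ k) =
      if j = 0 then (Fintype.card F : ℂ) - 1 else 0 := by
  have h6 : χ ^ 6 = 1 := hχ ▸ pow_orderOf_eq_one χ
  have hne : ∀ i, 0 < i → i < 6 → χ ^ i ≠ 1 := fun i h0 hi ↦
    pow_ne_one_of_lt_orderOf h0.ne' (hχ ▸ hi)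
  have hpow1 : ∀ (i : ℕ) (x : F), x ≠ 0 → χ x = 1 → (χ ^ i) x = 1 := by
    intro i x hx h
    obtain ⟨u, rfl⟩ := isUnit_iff_ne_zero.mpr hx
    rw [MulChar.pow_apply_coe, h, one_pow]
  have h40 : (4 : F) ≠ 0 := by
    rw [show (4 : F) = 2 * 2 by norm_num]
    exact mul_ne_zero h20 h20
  have hzero : ∀ i, 0 < i → i < 6 → jacobiSum 1 (χ ^ i) = -1 := fun i h0 hi ↦
    jacobiSum_one_nontrivial (hne i h0 hi)
  have hinv : ∀ i k, 0 < i → i < 6 → i + k = 6 → jacobiSum (χ ^ i) (χ ^ k) = -1 := by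
    intro i k h0 hi hik
    have : χ ^ k = (χ ^ i)⁻¹ := by
      rw [eq_inv_iff_mul_eq_one, ← pow_add, add_comm, hik, h6]
    rw [this, jacobiSum_nontrivial_inv (hne i h0 hi), hpow1 i (-1) (by simp) hχ1]
  have hsymm : ∀ i k m, 6 ∣ i + k + m →
      jacobiSum (χ ^ i) (χ ^ k) = jacobiSum (χ ^ i) (χ ^ m) := by
    intro i k m hm
    have : χ ^ m = (χ ^ i * χ ^ k)⁻¹ := by
      obtain ⟨d, hd⟩ := hm
      rw [eq_inv_iff_mul_eq_one, ← pow_add, ← pow_add, add_comm, hd, pow_mul, h6, one_pow]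
    rw [this, ← jacobiSum_eq_jacobiSum_mul_inv (hpow1 i (-1) (by simp) hχ1)]
  have hdup : ∀ i, 0 < i → i < 6 →
      jacobiSum (χ ^ i) (χ ^ i) = jacobiSum (χ ^ i) (χ ^ 3) := by
    intro i h0 hi
    rw [← jacobiSum_self_mul_apply_four h20 (hne i h0 hi) hφ, hpow1 i 4 h40 hχ4, mul_one]
  -- The orbit of `J(χ ^ 2, χ ^ 2)`.
  have h23 := hdup 2 (by norm_num) (by norm_num)
  have h21 := hsymm 2 3 1 (by norm_num)
  have h32 := jacobiSum_comm (χ ^ 2) (χ ^ 3)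
  have h31 := hsymm 3 2 1 (by norm_num)
  have h12 := jacobiSum_comm (χ ^ 2) (χ ^ 1)
  have h13 := jacobiSum_comm (χ ^ 3) (χ ^ 1)
  have h11 := hdup 1 (by norm_num) (by norm_num)
  have h14 := hsymm 1 1 4 (by norm_num)
  have h41 := jacobiSum_comm (χ ^ 1) (χ ^ 4)
  -- The orbit of `J(χ ^ 4, χ ^ 4)`.
  have h43 := hdup 4 (by norm_num) (by norm_num)
  have h45 := hsymm 4 3 5 (by norm_num)
  have h34 := jacobiSum_comm (χ ^ 4) (χ ^ 3)
  have h35 := hsymm 3 4 5 (by norm_num)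
  have h54 := jacobiSum_comm (χ ^ 4) (χ ^ 5)
  have h53 := jacobiSum_comm (χ ^ 3) (χ ^ 5)
  have h55 := hdup 5 (by norm_num) (by norm_num)
  have h52 := hsymm 5 5 2 (by norm_num)
  have h25 := jacobiSum_comm (χ ^ 5) (χ ^ 2)
  simp only [sum_range_succ, sum_range_zero]
  interval_cases j
  · rw [pow_zero χ, jacobiSum_one_one, hzero 1 (by norm_num) (by norm_num),
      hzero 2 (by norm_num) (by norm_num),
      hzero 3 (by norm_num) (by norm_num), hzero 4 (by norm_num) (by norm_num),
      hzero 5 (by norm_num) (by norm_num), if_pos rfl]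
    ring
  all_goals
    simp only [pow_zero χ]
    rw [jacobiSum_comm _ 1, hzero _ (by norm_num) (by norm_num), if_neg (by norm_num)]
  · linear_combination -h14 - h12 - h21 + h32 + h31 + h13 - hinv 1 5 (by norm_num) (by norm_num) rfl
  · linear_combination 2 * h23 + h21 + h43 + h34 + h35 + h53 - h55 + h52 + h25 - hJ +
      hinv 2 4 (by norm_num) (by norm_num) rfl
  · linear_combination h31 + h35 - hinv 3 3 (by norm_num) (by norm_num) rfl
  · linear_combination 2 * h43 + h45 + h23 + h32 + h31 + h13 - h11 + h14 + h41 - hJ +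
      hinv 4 2 (by norm_num) (by norm_num) rfl
  · linear_combination -h52 - h54 - h45 + h34 + h35 + h53 - hinv 5 1 (by norm_num) (by norm_num) rfl

/-- Orthogonality relation: the indicator function of a class of a sextic character. -/
theorem sum_pow_mul_mulChar_pow {F : Type*} [Field F] {χ : MulChar F ℂ}
    (hχ : χ ^ 6 = 1) {s : ℂ} (hs : s ^ 6 = 1) (x : F) :
    ∑ j ∈ range 6, s ^ j * (χ ^ j) x = if s * χ x = 1 then 6 else 0 := by
  by_cases hx : x = 0
  · simp [hx, MulChar.map_zero]
  · obtain ⟨u, rfl⟩ := isUnit_iff_ne_zero.mpr hx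
    have h6 : (s * χ u) ^ 6 = 1 := by
      rw [mul_pow, hs, ← MulChar.pow_apply_coe, hχ, MulChar.one_apply_coe, mul_one]
    simp_rw [MulChar.pow_apply_coe, ← mul_pow]
    split_ifs with h
    · simp [h]
    · have := geom_sum_mul (s * χ u) 6
      rw [h6, sub_self, mul_eq_zero, sub_eq_zero] at this
      exact this.resolve_right h

/-- Orthogonality of characters, summed against the vanishing of the alternating Jacobi sums: the
translate of the class `χ = -1` meets all classes of `χ` equally often. -/
theorem card_mulChar_eq_and_mulChar_one_sub {F : Type*} [Field F] [Fintype F] {χ : MulChar F ℂ}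
    (hχ : χ ^ 6 = 1)
    (hS : ∀ j < 6, ∑ k ∈ range 6, (-1) ^ k * jacobiSum (χ ^ j) (χ ^ k) =
      if j = 0 then (Fintype.card F : ℂ) - 1 else 0) (y : Fˣ) :
    36 * Nat.card {x : F // χ x = χ y ∧ χ (1 - x) = -1} + 1 = Fintype.card F := by
  classical
  have hy0 : χ y ≠ 0 := (y.isUnit.map χ).ne_zero
  have hs : (χ y)⁻¹ ^ 6 = 1 := by
    rw [inv_pow, ← MulChar.pow_apply_coe, hχ, MulChar.one_apply_coe, inv_one]
  have hcount : ∑ x : F, (∑ j ∈ range 6, (χ y)⁻¹ ^ j * (χ ^ j) x) *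
      (∑ k ∈ range 6, (-1) ^ k * (χ ^ k) (1 - x)) =
      36 * (Nat.card {x : F // χ x = χ y ∧ χ (1 - x) = -1} : ℂ) := by
    rw [Nat.card_eq_fintype_card, Fintype.card_subtype, ← sum_boole, mul_sum]
    refine sum_congr rfl fun x _ ↦ ?_
    rw [sum_pow_mul_mulChar_pow hχ hs, sum_pow_mul_mulChar_pow hχ (by norm_num)]
    have h1 : (χ y)⁻¹ * χ x = 1 ↔ χ x = χ y := by
      rw [inv_mul_eq_one₀ hy0, eq_comm]
    have h2 : -1 * χ (1 - x) = 1 ↔ χ (1 - x) = -1 := by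
      rw [neg_one_mul, neg_eq_iff_eq_neg]
    rw [if_congr h1 rfl rfl, if_congr h2 rfl rfl]
    by_cases ha : χ x = χ y <;> by_cases hb : χ (1 - x) = -1 <;> (simp [ha, hb]; try norm_num)
  have hswap : ∑ x : F, (∑ j ∈ range 6, (χ y)⁻¹ ^ j * (χ ^ j) x) *
      (∑ k ∈ range 6, (-1) ^ k * (χ ^ k) (1 - x)) =
      ∑ j ∈ range 6, (χ y)⁻¹ ^ j * ∑ k ∈ range 6, (-1) ^ k * jacobiSum (χ ^ j) (χ ^ k) := by
    simp_rw [sum_mul_sum, jacobiSum, mul_sum]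
    rw [sum_comm]
    refine sum_congr rfl fun j _ ↦ ?_
    rw [sum_comm]
    refine sum_congr rfl fun k _ ↦ sum_congr rfl fun x _ ↦ ?_
    ring
  rw [hcount, sum_congr rfl (g := fun j ↦ if j = 0 then (Fintype.card F : ℂ) - 1 else 0)
    (fun j hj ↦ by
      rw [hS j (mem_range.mp hj)]
      split_ifs with h
      · rw [h, pow_zero, one_mul]
      · rw [mul_zero]), sum_ite_eq' (range 6) 0, if_pos (by simp)] at hswap
  have : ((36 * Nat.card {x : F // χ x = χ y ∧ χ (1 - x) = -1} + 1 : ℕ) : ℂ) = Fintype.card F := by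
    push_cast
    rw [hswap]
    ring
  exact_mod_cast this

theorem mem_zpowers_pow_iff_mulChar_eq_one {F : Type*} [Field F] [Finite F] {ω : Fˣ}
    (hω : ∀ x : Fˣ, x ∈ Subgroup.zpowers ω) {χ : MulChar F ℂ} {ζ : ℂ} {e : ℕ}
    (hζ : IsPrimitiveRoot ζ e) (hχ : χ ω = ζ) (c : Fˣ) :
    c ∈ Subgroup.zpowers (ω ^ e) ↔ χ c = 1 := by
  constructor
  · intro h
    obtain ⟨m, rfl⟩ := mem_powers_iff_mem_zpowers.mpr h
    simp [hχ, hζ.pow_eq_one]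
  · intro h
    obtain ⟨n, rfl⟩ := mem_powers_iff_mem_zpowers.mpr (hω c)
    simp only [Units.val_pow_eq_pow_val, map_pow, hχ] at h
    obtain ⟨m, rfl⟩ := hζ.dvd_of_pow_eq_one n h
    exact ⟨m, by simp [pow_mul]⟩

theorem mem_cyclotomicCoset_iff_mulChar_eq {F : Type*} [Field F] [Finite F] {ω : Fˣ}
    (hω : ∀ x : Fˣ, x ∈ Subgroup.zpowers ω) {χ : MulChar F ℂ} {ζ : ℂ} {e i : ℕ}
    (hζ : IsPrimitiveRoot ζ e) (he : e ≠ 0) (hχ : χ ω = ζ) (x : F) :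
    x ∈ cyclotomicCoset ω e i ↔ χ x = ζ ^ i := by
  have hζ0 : ζ ^ i ≠ 0 := pow_ne_zero i (hζ.ne_zero he)
  constructor
  · rintro ⟨c, hc, rfl⟩
    have := (mem_zpowers_pow_iff_mulChar_eq_one hω hζ hχ c).mp hc
    simp [this, hχ]
  · intro h
    have hx : x ≠ 0 := by
      rintro rfl
      rw [MulChar.map_zero] at h
      exact hζ0 h.symm
    lift x to Fˣ using isUnit_iff_ne_zero.mpr hx
    refine ⟨(ω ^ i)⁻¹ * x, ?_, by simp⟩
    rw [mem_zpowers_pow_iff_mulChar_eq_one hω hζ hχ]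
    have h1 : χ ((ω ^ i * ((ω ^ i)⁻¹ * x) : Fˣ) : F) = ζ ^ i := by rw [mul_inv_cancel_left, h]
    rw [Units.val_mul, map_mul, Units.val_pow_eq_pow_val, map_pow, hχ] at h1
    exact mul_left_cancel₀ hζ0 (h1.trans (mul_one _).symm)

/-- All cyclotomic numbers `(3, i)` of order six are equal: every translate condition
`c * y + 1 ∈ C₃` with `y ≠ 0` has the same number of solutions `c ∈ C₀`. -/
theorem exists_card_mul_add_one_mem_cyclotomicCoset {F : Type*} [Field F] [Fintype F] {b : ℤ}
    (hb : Even b) (hq : (Fintype.card F : ℤ) = 1 + 3 * b ^ 2) (h2 : ∃ c : F, c ^ 3 = 2) {ω : Fˣ}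
    (hω : ∀ x : Fˣ, x ∈ Subgroup.zpowers ω) :
    ∃ u : ℕ, 0 < u ∧ Fintype.card F = 36 * u + 1 ∧
      Nat.card (Subgroup.zpowers (ω ^ 6)) = 6 * u ∧ (1 : F) ∉ cyclotomicCoset ω 6 3 ∧
      ∀ y : F, y ≠ 0 → Nat.card {c : Subgroup.zpowers (ω ^ 6) //
        ((c : Fˣ) : F) * y + 1 ∈ cyclotomicCoset ω 6 3} = u := by
  classical
  have h1q := Fintype.one_lt_card (α := F)
  obtain ⟨m, hm⟩ : ∃ m, Fintype.card F = 12 * m + 1 := by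
    obtain ⟨d, rfl⟩ := hb
    refine ⟨(d ^ 2).toNat, ?_⟩
    have := sq_nonneg d
    ring_nf at hq
    omega
  have hm0 : m ≠ 0 := by omega
  have hordω : orderOf ω = 12 * m := by
    rw [orderOf_eq_card_of_forall_mem_zpowers hω, Nat.card_eq_fintype_card, Fintype.card_units, hm]
    rfl
  -- The sextic character.
  obtain ⟨ζ, hζ⟩ : ∃ ζ : ℂ, IsPrimitiveRoot ζ 6 := ⟨_, Complex.isPrimitiveRoot_exp 6 (by norm_num)⟩
  have hζu : (hζ.isUnit (by norm_num)).unit ∈ rootsOfUnity (Fintype.card Fˣ) ℂ := by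
    rw [mem_rootsOfUnity', IsUnit.unit_spec, Fintype.card_units, hm, Nat.add_sub_cancel,
      show 12 * m = 6 * (2 * m) by ring, pow_mul, hζ.pow_eq_one, one_pow]
  obtain ⟨χ, hχ⟩ : ∃ χ : MulChar F ℂ, χ ω = ζ :=
    ⟨MulChar.ofRootOfUnity hζu hω, by rw [MulChar.ofRootOfUnity_spec, IsUnit.unit_spec]⟩
  have hχpow : ∀ i : ℕ, (χ ^ i) ω = ζ ^ i := fun i ↦ by rw [MulChar.pow_apply_coe, hχ]
  have hord : orderOf χ = 6 := by
    refine (orderOf_eq_iff (by norm_num)).mpr ⟨?_, fun i hi h0 h ↦ ?_⟩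
    · rw [MulChar.eq_iff hω, hχpow, hζ.pow_eq_one, MulChar.one_apply_coe]
    · have := hχpow i
      rw [h, MulChar.one_apply_coe] at this
      exact hζ.pow_ne_one_of_pos_of_lt h0.ne' hi this.symm
  have h6 : χ ^ 6 = 1 := hord ▸ pow_orderOf_eq_one χ
  have hζ3 : ζ ^ 3 = -1 := by
    have h1 : (ζ ^ 3) ^ 2 = 1 := by rw [← pow_mul, hζ.pow_eq_one]
    exact (eq_or_eq_neg_of_sq_eq_sq _ 1 (by rw [h1, one_pow])).resolve_left
      (hζ.pow_ne_one_of_pos_of_lt (by norm_num) (by norm_num))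
  have h20 : (2 : F) ≠ 0 := by
    intro h
    have h3 := FiniteField.cast_card_eq_zero F
    rw [hm] at h3
    push_cast at h3
    exact one_ne_zero (α := F) (by linear_combination h3 - 6 * (m : F) * h)
  -- As `12 ∣ q - 1`, the element `-1` is a sixth power.
  have hχ1 : χ (-1) = 1 := by
    have hne : (ω : F) ^ (6 * m) ≠ 1 := by
      intro h
      exact pow_ne_one_of_lt_orderOf (x := ω) (n := 6 * m) (by omega) (by omega)
        (Units.ext (by simpa using h))
    have hsq : ((ω : F) ^ (6 * m)) ^ 2 = 1 := by
      rw [← pow_mul, show 6 * m * 2 = Fintype.card F - 1 by omega]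
      exact FiniteField.pow_card_sub_one_eq_one _ ω.ne_zero
    rw [← (eq_or_eq_neg_of_sq_eq_sq _ 1 (by rw [hsq, one_pow])).resolve_left hne,
      map_pow, hχ, pow_mul, hζ.pow_eq_one, one_pow]
  have hχ4 : χ 4 = 1 := by
    obtain ⟨c, hc⟩ := h2
    have hc0 : c ≠ 0 := by rintro rfl; exact h20 (by rw [← hc]; norm_num)
    obtain ⟨v, rfl⟩ := isUnit_iff_ne_zero.mpr hc0
    rw [show (4 : F) = (v : F) ^ 6 by rw [show (6 : ℕ) = 3 * 2 from rfl, pow_mul, hc]; norm_num,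
      map_pow, ← MulChar.pow_apply_coe, h6, MulChar.one_apply_coe]
  have hφ : ∀ x : F, (χ ^ 3) x = quadraticChar F x := by
    have hns : ¬ IsSquare (ω : F) := by
      rintro ⟨v, hv⟩
      have hv0 : v ≠ 0 := by rintro rfl; simp at hv
      obtain ⟨v, rfl⟩ := isUnit_iff_ne_zero.mpr hv0
      have h3 := hχpow 3
      rw [hv, map_mul, ← pow_two, MulChar.pow_apply_coe, ← pow_mul, ← MulChar.pow_apply_coe, h6,
        MulChar.one_apply_coe, hζ3] at h3
      norm_num at h3
    have : χ ^ 3 = (quadraticChar F).ringHomComp (Int.castRingHom ℂ) := by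
      rw [MulChar.eq_iff hω, hχpow, hζ3, MulChar.ringHomComp_apply,
        quadraticChar_neg_one_iff_not_isSquare.mpr hns]
      simp
    intro x
    rw [this]; rfl
  have hJ : jacobiSum (χ ^ 2) (χ ^ 2) + jacobiSum (χ ^ 4) (χ ^ 4) = -2 := by
    have hinv : χ ^ 4 = (χ ^ 2)⁻¹ := by rw [eq_inv_iff_mul_eq_one, ← pow_add, h6]
    rw [hinv]
    exact jacobiSum_self_add_jacobiSum_inv hb hq h2 hω
      (hζ.pow (by norm_num) (show 6 = 2 * 3 by norm_num)) (hχpow 2)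
  have hcount := card_mulChar_eq_and_mulChar_one_sub h6 fun j hj ↦
    sum_neg_one_pow_mul_jacobiSum h20 hord hχ1 hχ4 hφ hJ hj
  have hmem : ∀ x : F, x ∈ cyclotomicCoset ω 6 3 ↔ χ x = -1 := fun x ↦ by
    rw [mem_cyclotomicCoset_iff_mulChar_eq hω hζ (by norm_num) hχ, hζ3]
  obtain ⟨u, hu⟩ : ∃ u, Nat.card {x : F // χ x = χ (1 : Fˣ) ∧ χ (1 - x) = -1} = u := ⟨_, rfl⟩
  have hu1 := hcount 1
  rw [hu] at hu1
  refine ⟨u, by omega, hu1.symm, ?_, ?_, ?_⟩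
  · rw [Nat.card_zpowers, orderOf_pow, hordω, Nat.gcd_eq_right ⟨2 * m, by ring⟩]
    omega
  · rw [hmem, map_one]; norm_num
  · intro y hy
    lift y to Fˣ using isUnit_iff_ne_zero.mpr hy
    have hy1 := hcount y
    have : Nat.card {x : F // χ x = χ y ∧ χ (1 - x) = -1} = u := by omega
    rw [← this]
    have hneg : ∀ x : F, χ (-x) = χ x := fun x ↦ by rw [neg_eq_neg_one_mul, map_mul, hχ1, one_mul]
    refine Nat.card_congr (Equiv.ofBijective (fun c ↦ ⟨-(((c : Subgroup.zpowers (ω ^ 6)) : Fˣ) * y),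
      ?_, ?_⟩) ⟨?_, ?_⟩)
    · rw [hneg, map_mul, (mem_zpowers_pow_iff_mulChar_eq_one hω hζ hχ _).mp c.1.2, one_mul]
    · rw [sub_neg_eq_add, add_comm]
      exact (hmem _).mp c.2
    · intro c c' h
      have h3 := congrArg Subtype.val h
      simp only [neg_inj] at h3
      exact Subtype.ext (Subtype.ext (Units.ext (mul_right_cancel₀ y.ne_zero h3)))
    · rintro ⟨x, hx1, hx2⟩
      have hx0 : x ≠ 0 := by
        rintro rfl
        rw [MulChar.map_zero] at hx1
        exact (y.isUnit.map χ).ne_zero hx1.symm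
      lift x to Fˣ using isUnit_iff_ne_zero.mpr hx0
      have hxy : ((-x * y⁻¹ : Fˣ) : F) * y = -x := by simp
      refine ⟨⟨⟨-x * y⁻¹, ?_⟩, ?_⟩, ?_⟩
      · rw [mem_zpowers_pow_iff_mulChar_eq_one hω hζ hχ]
        have h3 : χ (((-x * y⁻¹ : Fˣ) : F) * y) = χ y := by rw [hxy, hneg, hx1]
        rw [map_mul] at h3
        exact mul_right_cancel₀ (y.isUnit.map χ).ne_zero (h3.trans (one_mul _).symm)
      · rw [hmem]
        change χ (((-x * y⁻¹ : Fˣ) : F) * y + 1) = -1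
        rw [hxy, ← hx2]
        congr 1; ring
      · ext
        simp

end JacobiSums

/-! ### The Cayley digraph on the semidirect product -/

/-- The action of `Fˣ` on the additive group of `F` by multiplication. -/
def multiplierHom (F : Type*) [Field F] : Fˣ →* MulAut (Multiplicative F) where
  toFun c := AddEquiv.toMultiplicative (DistribMulAction.toAddEquiv F c)
  map_one' := by ext x; simp
  map_mul' c d := by ext x; simp [mul_smul]

theorem multiplierHom_apply {F : Type*} [Field F] (c : Fˣ) (x : Multiplicative F) :
    multiplierHom F c x = Multiplicative.ofAdd ((c : F) * x.toAdd) := rfl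

theorem multiplierHom_injective (F : Type*) [Field F] : Function.Injective (multiplierHom F) := by
  intro c d h
  have := congrArg (fun a ↦ (a (Multiplicative.ofAdd 1)).toAdd) h
  exact Units.ext (by simpa [multiplierHom_apply] using this)

theorem map_multiplierHom_zpowers {F : Type*} [Field F] (ω : Fˣ) (e : ℕ) :
    (Subgroup.zpowers (ω ^ e)).map (multiplierHom F) = multiplierGroup ω e := by
  rw [MonoidHom.map_zpowers]; rfl

/-- Coordinates on `H ⋊ K`: a field element and a multiplier. -/
noncomputable def fieldSemidirectEquiv {F : Type*} [Field F] (ω : Fˣ) (e : ℕ) :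
    F × Subgroup.zpowers (ω ^ e) ≃ FieldSemidirect ω e :=
  (Equiv.prodCongr Multiplicative.ofAdd
    (((Subgroup.zpowers (ω ^ e)).equivMapOfInjective _ (multiplierHom_injective F)).trans
      (MulEquiv.subgroupCongr (map_multiplierHom_zpowers ω e))).toEquiv).trans
    SemidirectProduct.equivProd.symm

theorem mem_shiftedSet_iff {F : Type*} [Field F] {ω : Fˣ} {e : ℕ} {D : Set F}
    (g : FieldSemidirect ω e) : g ∈ shiftedSet ω e D ↔ g.left.toAdd + 1 ∈ D := by
  constructor
  · rintro ⟨d, hd, h⟩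
    rw [h]
    simpa using hd
  · intro h
    exact ⟨_, h, by simp⟩

theorem fieldSemidirectEquiv_mem_shiftedSet {F : Type*} [Field F] {ω : Fˣ} {e : ℕ} {D : Set F}
    (p : F × Subgroup.zpowers (ω ^ e)) :
    fieldSemidirectEquiv ω e p ∈ shiftedSet ω e D ↔ p.1 + 1 ∈ D :=
  mem_shiftedSet_iff _

theorem fieldSemidirectEquiv_inv_mul_mem_shiftedSet {F : Type*} [Field F] {ω : Fˣ} {e : ℕ}
    {D : Set F} (p : F × Subgroup.zpowers (ω ^ e)) (g : FieldSemidirect ω e) :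
    (fieldSemidirectEquiv ω e p)⁻¹ * g ∈ shiftedSet ω e D ↔
      (((p.2⁻¹ : Subgroup.zpowers (ω ^ e)) : Fˣ) : F) * (g.left.toAdd - p.1) + 1 ∈ D := by
  rw [mem_shiftedSet_iff]
  have h1 : ((fieldSemidirectEquiv ω e p)⁻¹ * g).left =
      (multiplierHom F (p.2 : Fˣ))⁻¹ (Multiplicative.ofAdd p.1)⁻¹ *
        (multiplierHom F (p.2 : Fˣ))⁻¹ g.left := rfl
  have h2 : ((fieldSemidirectEquiv ω e p)⁻¹ * g).left.toAdd =
      (((p.2⁻¹ : Subgroup.zpowers (ω ^ e)) : Fˣ) : F) * (g.left.toAdd - p.1) := by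
    rw [h1, ← map_inv, multiplierHom_apply, multiplierHom_apply]
    simp [mul_sub]
    ring
  rw [h2]

theorem card_fieldSemidirect {F : Type*} [Field F] [Finite F] (ω : Fˣ) (e : ℕ) :
    Nat.card (FieldSemidirect ω e) = Nat.card F * Nat.card (Subgroup.zpowers (ω ^ e)) := by
  rw [← Nat.card_congr (fieldSemidirectEquiv ω e), Nat.card_prod]

theorem card_add_one_mem {F : Type*} [Field F] (D : Set F) :
    Nat.card {h : F // h + 1 ∈ D} = Nat.card D :=
  Nat.card_congr ((Equiv.addRight (1 : F)).subtypeEquiv fun _ ↦ Iff.rfl)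

theorem ncard_shiftedSet {F : Type*} [Field F] [Finite F] (ω : Fˣ) (e : ℕ) (D : Set F) :
    (shiftedSet ω e D).ncard = Nat.card D * Nat.card (Subgroup.zpowers (ω ^ e)) := by
  rw [← Nat.card_coe_set_eq, ← card_add_one_mem D, ← Nat.card_prod]
  refine Nat.card_congr (Equiv.trans ?_ (Equiv.prodSubtypeFstEquivSubtypeProd
    (p := fun h : F ↦ h + 1 ∈ D)))
  exact ((fieldSemidirectEquiv ω e).subtypeEquiv fun p ↦
    (fieldSemidirectEquiv_mem_shiftedSet p).symm).symm

open Finset in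
/-- The multiplicity of `g` in the product `W * W`: an element `(h, c)` of `W` with `h` different
from the translation part of `g` has `u` completions, and there is none for the remaining `h`, which
occurs exactly when `g ∈ W`. -/
theorem card_mul_shiftedSet {F : Type*} [Field F] [Finite F] {ω : Fˣ} {e : ℕ} {D : Set F} {u : ℕ}
    (hD1 : (1 : F) ∉ D)
    (hu : ∀ y : F, y ≠ 0 →
      Nat.card {c : Subgroup.zpowers (ω ^ e) // ((c : Fˣ) : F) * y + 1 ∈ D} = u)
    (g : FieldSemidirect ω e) [Decidable (g ∈ shiftedSet ω e D)] :
    {a | a ∈ shiftedSet ω e D ∧ a⁻¹ * g ∈ shiftedSet ω e D}.ncard =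
      (Nat.card D - if g ∈ shiftedSet ω e D then 1 else 0) * u := by
  classical
  have := Fintype.ofFinite F
  have := Fintype.ofFinite (Subgroup.zpowers (ω ^ e))
  have hfib : ∀ y : F, #{c : Subgroup.zpowers (ω ^ e) |
      (((c⁻¹ : Subgroup.zpowers (ω ^ e)) : Fˣ) : F) * y + 1 ∈ D} = if y = 0 then 0 else u := by
    intro y
    split_ifs with hy
    · simp [hy, hD1]
    · rw [← hu y hy, ← Fintype.card_subtype, ← Nat.card_eq_fintype_card]
      exact Nat.card_congr ((Equiv.inv _).subtypeEquiv fun _ ↦ Iff.rfl)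
  have hcoord : {a | a ∈ shiftedSet ω e D ∧ a⁻¹ * g ∈ shiftedSet ω e D}.ncard =
      #{p : F × Subgroup.zpowers (ω ^ e) | p.1 + 1 ∈ D ∧
        (((p.2⁻¹ : Subgroup.zpowers (ω ^ e)) : Fˣ) : F) * (g.left.toAdd - p.1) + 1 ∈ D} := by
    rw [← Nat.card_coe_set_eq, ← Fintype.card_subtype, ← Nat.card_eq_fintype_card]
    refine Nat.card_congr ((fieldSemidirectEquiv ω e).subtypeEquiv fun p ↦ ?_).symm
    rw [Set.mem_ofPred_eq, fieldSemidirectEquiv_mem_shiftedSet,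
      fieldSemidirectEquiv_inv_mul_mem_shiftedSet]
  have hsum : #{p : F × Subgroup.zpowers (ω ^ e) | p.1 + 1 ∈ D ∧
        (((p.2⁻¹ : Subgroup.zpowers (ω ^ e)) : Fˣ) : F) * (g.left.toAdd - p.1) + 1 ∈ D} =
      ∑ h : F with h + 1 ∈ D, if g.left.toAdd - h = 0 then 0 else u := by
    rw [card_filter, Fintype.sum_prod_type, sum_filter]
    refine sum_congr rfl fun h _ ↦ ?_
    rw [← hfib, card_filter]
    split_ifs with hh <;> simp [hh]
  have herase : ({h : F | h + 1 ∈ D} : Finset F).filter (fun h ↦ ¬ g.left.toAdd - h = 0) =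
      ({h : F | h + 1 ∈ D} : Finset F).erase g.left.toAdd := by
    ext h
    simp only [mem_filter, mem_erase, mem_univ, true_and, sub_eq_zero,
      eq_comm (a := g.left.toAdd)]
    exact and_comm
  rw [hcoord, hsum, sum_ite, sum_const_zero, zero_add, sum_const, smul_eq_mul, herase,
    card_erase_eq_ite, ← card_add_one_mem, Nat.card_eq_fintype_card, Fintype.card_subtype]
  congr 1
  simp only [mem_shiftedSet_iff, mem_filter, mem_univ, true_and]
  split_ifs <;> simp

/-- If every condition `c * y + 1 ∈ D` with `y ≠ 0` has the same number `u` of solutions `c` in the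
multiplier group, the Cayley digraph of `(-1 + D, K)` is a directed strongly regular graph. -/
theorem isDSRG_cayleyDigraph_shiftedSet {F : Type*} [Field F] [Finite F] {ω : Fˣ} {e : ℕ}
    {D : Set F} {u : ℕ} (hD1 : (1 : F) ∉ D)
    (hu : ∀ y : F, y ≠ 0 →
      Nat.card {c : Subgroup.zpowers (ω ^ e) // ((c : Fˣ) : F) * y + 1 ∈ D} = u) :
    IsDSRG (cayleyDigraph (shiftedSet ω e D))
      (Nat.card F * Nat.card (Subgroup.zpowers (ω ^ e)))
      (Nat.card D * Nat.card (Subgroup.zpowers (ω ^ e)))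
      ((Nat.card D - 1) * u) (Nat.card D * u) (Nat.card D * u) := by
  classical
  have h1 : (1 : FieldSemidirect ω e) ∉ shiftedSet ω e D := by
    rw [mem_shiftedSet_iff]
    simpa using hD1
  have hpaths : ∀ x y : FieldSemidirect ω e,
      {z | (cayleyDigraph (shiftedSet ω e D)).Adj x z ∧
        (cayleyDigraph (shiftedSet ω e D)).Adj z y}.ncard =
      (Nat.card D - if x⁻¹ * y ∈ shiftedSet ω e D then 1 else 0) * u := by
    intro x y
    rw [← card_mul_shiftedSet hD1 hu, ← Nat.card_coe_set_eq, ← Nat.card_coe_set_eq]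
    refine Nat.card_congr ((Equiv.mulLeft x⁻¹).subtypeEquiv fun z ↦ ?_)
    simp [cayleyDigraph, mul_assoc]
  refine ⟨Finite.of_equiv _ (fieldSemidirectEquiv ω e), card_fieldSemidirect ω e, ?_, ?_, ?_, ?_,
    ?_, ?_⟩
  · intro x
    simpa [cayleyDigraph] using h1
  · intro x
    rw [← ncard_shiftedSet, ← Nat.card_coe_set_eq, ← Nat.card_coe_set_eq]
    exact Nat.card_congr ((Equiv.mulLeft x⁻¹).subtypeEquiv fun z ↦ Iff.rfl)
  · intro x
    rw [← ncard_shiftedSet, ← Nat.card_coe_set_eq, ← Nat.card_coe_set_eq]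
    exact Nat.card_congr (((Equiv.inv _).trans (Equiv.mulRight x)).subtypeEquiv fun z ↦ Iff.rfl)
  · intro x
    rw [hpaths x x, if_neg (by simpa using h1), tsub_zero]
  · intro x y _ hxy
    rw [hpaths x y, if_pos (show x⁻¹ * y ∈ _ from hxy)]
  · intro x y _ hxy
    rw [hpaths x y, if_neg (show x⁻¹ * y ∉ _ from hxy), tsub_zero]

theorem card_cyclotomicCoset {F : Type*} [Field F] (ω : Fˣ) (e i : ℕ) :
    Nat.card (cyclotomicCoset ω e i) = Nat.card (Subgroup.zpowers (ω ^ e)) := by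
  refine (Nat.card_congr (Equiv.ofBijective
    (fun c : Subgroup.zpowers (ω ^ e) ↦ (⟨_, c, c.2, rfl⟩ : cyclotomicCoset ω e i)) ⟨?_, ?_⟩)).symm
  · intro c d h
    exact Subtype.ext (mul_left_cancel (Units.ext (congrArg Subtype.val h)))
  · rintro ⟨x, c, hc, rfl⟩
    exact ⟨⟨c, hc⟩, rfl⟩

theorem theorem4p6 {F : Type*} [Field F] [Fintype F] (q : ℕ) (hq : Fintype.card F = q)
    (b : ℤ) (hb : Even b) (hqb : (q : ℤ) = 1 + 3 * b ^ 2)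
    (h2 : ∃ c : F, c ^ 3 = 2)
    (ω : Fˣ) (hω : ∀ x : Fˣ, x ∈ Subgroup.zpowers ω) :
    ∃ v k lam mu t : ℕ,
      (v : ℚ) = ((q : ℚ) - 1) * q / 6 ∧
      (k : ℚ) = ((q : ℚ) - 1) ^ 2 / 36 ∧
      (lam : ℚ) = ((q : ℚ) - 1) ^ 2 / 216 - ((q : ℚ) - 1) / 36 ∧
      (mu : ℚ) = ((q : ℚ) - 1) ^ 2 / 216 ∧
      (t : ℚ) = ((q : ℚ) - 1) ^ 2 / 216 ∧
      0 < t ∧ t < k ∧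
      IsDSRG (cayleyDigraph (shiftedSet ω 6 (cyclotomicCoset ω 6 3))) v k lam mu t := by
  obtain ⟨u, hu0, hqu, hK, h1, hcount⟩ :=
    exists_card_mul_add_one_mem_cyclotomicCoset hb (by rw [hq]; exact hqb) h2 hω
  have hdsrg := isDSRG_cayleyDigraph_shiftedSet h1 hcount
  rw [card_cyclotomicCoset, hK, Nat.card_eq_fintype_card, hqu] at hdsrg
  rw [← hq, hqu]
  refine ⟨_, _, _, _, _, ?_, ?_, ?_, ?_, ?_, ?_, ?_, hdsrg⟩
  · push_cast; ring
  · push_cast; ring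
  · rw [Nat.cast_mul, Nat.cast_sub (by omega)]
    push_cast; ring
  · push_cast; ring
  · push_cast; ring
  · positivity
  · exact Nat.mul_lt_mul_of_pos_left (by omega) (by omega)
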